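/- Let $(G_n)_{n\ge 0}$ be the following finite multigraphs, with edges labelled $a$ or $b$ and two boundary vertices. $G_0$ is the complete graph on two vertices, its edge labelled $a$, both vertices being boundary vertices. $G_{n+1}$ is obtained from $G_n$ by keeping all vertices and the two boundary vertices, turning each $b$-edge into an $a$-edge, and replacing each $a$-edge (or $a$-loop) with ends $x,y$ by a new vertex $z$ that carries an $a$-loop and is joined by one $b$-edge to $x$ and one $b$-edge to $y$ (two $b$-edges if $x=y$). Let $c_{xy}$ be the number of edges joining $x$ and $y$. The Dirichlet Laplacian of $G_n$ acts on real functions $f$ on the non-boundary vertices, extended by $0$ to the boundary, by $Lf(x)=\sum_y c_{xy}(f(x)-f(y))$ at non-boundary $x$. Let $c_n\in\mathbb R[\lambda]$ be its (monic) characteristic polynomial. Call $(\gamma_n)_{n\ge0}$ in $\mathbb R[\lambda]$ a sequence of new factors, with exponents $s_{n,k}\in\mathbb N=\{0,1,2,\dots\}$ ($1\le k<n$), if $\gamma_0=1$, each $\gamma_n$ is coprime to $\gamma_k$ for all $k<n$, and $c_n=\gamma_n\prod_{k=1}^{n-1}\gamma_k^{s_{n,k}}$ for all $n\ge1$. **Theorem.**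 The numbers $$S_n=\frac{9+23(-1)^n+2^{n+2}-6n(-1)^n}{36}\qquad(n\ge0)$$ are non-negative integers. A sequence of new factors exists, and for every such sequence: 1. $s_{n,k}=S_{n-k}$ for all $1\le k<n$; that is, $c_n=\gamma_n\prod_{k=1}^{n-1}\gamma_k^{S_{n-k}}$ for all $n\ge1$ (in particular the sequence is unique). 2. Each $\gamma_k$ has only real roots, all of them simple, and the $\gamma_k$ are pairwise coprime. Consequently, if $\lambda\in\mathbb R$ is a Dirichlet eigenvalue of $G_k$ but not of $G_j$ for any $j<k$, then for every $n\ge k$ its multiplicity on $G_n$ (the multiplicity as a root of $c_n$, and the dimension of the eigenspace) is exactly $S_{n-k}$, where multiplicity $0$ means that $\lambda$ is not an eigenvalue. -/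

import Mathlib

open Polynomial

namespace Basilica

/-- A finite multigraph (loops and multiple edges allowed) whose edges carry a label `a` or `b`,
together with two marked (boundary) vertices. The types `A` and `B` are the sets of `a`-edges and
of `b`-edges; the two ends of an edge are listed by `Bool` in an arbitrary order. -/
structure EdgeLabelledGraph where
  V : Type
  A : Type
  B : Type
  [fintypeV : Fintype V]
  [decEqV : DecidableEq V]
  [fintypeA : Fintype A]
  [decEqA : DecidableEq A]
  [fintypeB : Fintype B]
  [decEqB : DecidableEq B]
  aEnd : A → Bool → V
  bEnd : B → Bool → V
  bdry : Bool → V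

attribute [instance] EdgeLabelledGraph.fintypeV EdgeLabelledGraph.decEqV
  EdgeLabelledGraph.fintypeA EdgeLabelledGraph.decEqA
  EdgeLabelledGraph.fintypeB EdgeLabelledGraph.decEqB

/-- The complete graph on two vertices, its single edge labelled `a`, both vertices marked. -/
def seed : EdgeLabelledGraph where
  V := Bool
  A := Unit
  B := Empty
  aEnd := fun _ i => i
  bEnd := fun e _ => e.elim
  bdry := fun i => i

/-- One application of the replacement rules. Every old vertex is kept and every `a`-edge `e` has a
new vertex, written `Sum.inr e`.
* A `b`-edge becomes an `a`-edge with the same ends.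
* An `a`-edge `e` between `x` and `y` becomes two `b`-edges, from the new vertex to `x` and
  from the new vertex to `y`, and an `a`-loop is put at the new vertex. If `e` is a loop at `x`, this
  yields two `b`-edges between `x` and the new vertex. -/
def EdgeLabelledGraph.replace (G : EdgeLabelledGraph) : EdgeLabelledGraph where
  V := G.V ⊕ G.A
  A := G.B ⊕ G.A
  B := G.A × Bool
  aEnd := Sum.elim (fun e i => Sum.inl (G.bEnd e i)) (fun e _ => Sum.inr e)
  bEnd := fun e i => bif i then Sum.inr e.1 else Sum.inl (G.aEnd e.1 e.2)
  bdry := fun i => Sum.inl (G.bdry i)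

/-- The graph `G_n`. -/
def graph : ℕ → EdgeLabelledGraph
  | 0 => seed
  | n + 1 => (graph n).replace

namespace EdgeLabelledGraph

variable (G : EdgeLabelledGraph)

/-- The number `c_{xy}` of edges, of either label, joining `x` and `y`. -/
def edgeCount (x y : G.V) : ℕ :=
  Fintype.card {e : G.A // s(G.aEnd e false, G.aEnd e true) = s(x, y)} +
    Fintype.card {e : G.B // s(G.bEnd e false, G.bEnd e true) = s(x, y)}

/-- The Laplacian `L f (x) = ∑ y, c_{xy} (f x - f y)`. -/
def laplacian : (G.V → ℝ) →ₗ[ℝ] (G.V → ℝ) where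
  toFun f x := ∑ y, (G.edgeCount x y : ℝ) * (f x - f y)
  map_add' f g := by
    ext x
    simp only [Pi.add_apply, ← Finset.sum_add_distrib]
    exact Finset.sum_congr rfl fun y _ => by ring
  map_smul' r f := by
    ext x
    simp only [Pi.smul_apply, smul_eq_mul, RingHom.id_apply, Finset.mul_sum]
    exact Finset.sum_congr rfl fun y _ => by ring

/-- The non-boundary vertices. -/
abbrev Interior : Type := {x : G.V // ∀ i, x ≠ G.bdry i}

/-- The Dirichlet Laplacian: a function on the interior is extended by zero to the boundary, the
Laplacian is applied, and the result is restricted to the interior. -/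
noncomputable def dirichletLaplacian : Module.End ℝ (G.Interior → ℝ) :=
  LinearMap.funLeft ℝ ℝ (Subtype.val : G.Interior → G.V) ∘ₗ G.laplacian ∘ₗ
    Function.ExtendByZero.linearMap ℝ (Subtype.val : G.Interior → G.V)

end EdgeLabelledGraph

/-- The Dirichlet Laplacian of `G_n`. -/
noncomputable def dirichlet (n : ℕ) : Module.End ℝ ((graph n).Interior → ℝ) :=
  (graph n).dirichletLaplacian

/-- The Dirichlet characteristic polynomial `c_n` of `G_n`. -/
noncomputable def c (n : ℕ) : ℝ[X] := LinearMap.charpoly (dirichlet n)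

/-- `γ` is the sequence of new factors of the `c_n`, with exponents `s n k`: `γ_0 = 1`, each `γ_n`
is coprime to all earlier ones, and `c_n = γ_n ∏_{k=1}^{n-1} γ_k ^ s_{n,k}`. -/
structure IsNewFactorSequence (γ : ℕ → ℝ[X]) (s : ℕ → ℕ → ℕ) : Prop where
  zero : γ 0 = 1
  coprime : ∀ n k, k < n → IsCoprime (γ n) (γ k)
  factor : ∀ n, 1 ≤ n → c n = γ n * ∏ k ∈ Finset.Ico 1 n, γ k ^ s n k

end Basilica

namespace Basilica
open Filter Topology

/-! Remove the youngest vertices from t - L by a Schur complement. No two of them are adjacent, so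
their block is the scalar `pivot`, and the complement is a matrix of the same kind on the previous
graph with new edge weights. Iterating gives c_n(t) = ∏_{i<n} pivot_i(t)^{numA (n-1-i)} where no
pivot vanishes (`eval_c`), hence c_{n+2} = c_{n+1} c_n² pivot_{n+1} (`eval_c_add_two`).

Fix x and let k be the least index with pivot_k(x) = 0. The response of an edge is monotone in t, so
this zero is simple. From there on the orders of the pivots at x are 1, -1, -1, 0, -1, 0, ...,
whatever x is (`hasOrderAt_pivot_add`), and the recursion forces x to have multiplicity `mult m` in
c_{k+1+m}. If no pivot vanishes at x, then x is a root of no c_n.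

By symmetry of L each c_n splits, so it is a product of powers of the simple-rooted polynomials that
collect the roots appearing first at each level. The exponents are unique because none of these
polynomials at a level ≥ 1 is constant, which follows from a degree count
(`natDegree_newFactor_ne_zero`). -/

/-! ### Edge weights and their monotonicity -/

/-- The effective weights of the network obtained from one edge: at parameter `t` the network
contributes `(weights n t).1` to the diagonal entry at each of its two ends and
`-(weights n t).2` to the off-diagonal entry. -/
noncomputable def weights : ℕ → ℝ → ℝ × ℝ
  | 0, _ => (1, 1)
  | 1, _ => (1, 1)
  | n + 2, t =>
    let d := t - 2 * (weights n t).1 - 2 * ((weights (n + 1) t).1 - (weights (n + 1) t).2)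
    ((weights n t).1 + (weights n t).2 ^ 2 / d, -((weights n t).2 ^ 2 / d))

/-- The diagonal weight. -/
noncomputable def dw (n : ℕ) (t : ℝ) : ℝ := (weights n t).1

/-- The off-diagonal weight. -/
noncomputable def ow (n : ℕ) (t : ℝ) : ℝ := (weights n t).2

/-- The pivot that is divided by when the vertices of the last generation are eliminated. -/
noncomputable def pivot (n : ℕ) (t : ℝ) : ℝ :=
  t - 2 * dw n t - 2 * (dw (n + 1) t - ow (n + 1) t)

lemma dw_zero (t : ℝ) : dw 0 t = 1 := by simp [dw, weights]
lemma dw_one (t : ℝ) : dw 1 t = 1 := by simp [dw, weights]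
lemma ow_zero (t : ℝ) : ow 0 t = 1 := by simp [ow, weights]
lemma ow_one (t : ℝ) : ow 1 t = 1 := by simp [ow, weights]

lemma dw_add_two (n : ℕ) (t : ℝ) : dw (n + 2) t = dw n t + ow n t ^ 2 / pivot n t := by
  simp [dw, ow, pivot, weights]

lemma ow_add_two (n : ℕ) (t : ℝ) : ow (n + 2) t = -(ow n t ^ 2 / pivot n t) := by
  simp [dw, ow, pivot, weights]

/-- The weights are regular at `x`, and the response is monotone in the parameter. -/
structure RegularAt (n : ℕ) (x : ℝ) : Prop where
  ow_ne : ow n x ≠ 0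
  deriv : ∃ p q : ℝ, HasDerivAt (dw n) p x ∧ HasDerivAt (ow n) q x ∧ p - q ≤ 0 ∧ p + q ≤ 0

lemma RegularAt.hasDerivAt_pivot {n : ℕ} {x : ℝ} (h : RegularAt n x) (h' : RegularAt (n + 1) x) :
    ∃ d : ℝ, HasDerivAt (pivot n) d x ∧ 0 < d := by
  obtain ⟨p, q, hp, hq, h1, h2⟩ := h.deriv
  obtain ⟨p', q', hp', hq', h1', h2'⟩ := h'.deriv
  refine ⟨1 - 2 * p - 2 * (p' - q'), ?_, by linarith⟩
  exact ((hasDerivAt_id x).sub (hp.const_mul 2)).sub ((hp'.sub hq').const_mul 2)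

/-- The response matrix of an edge has diagonal `dw` and off-diagonal `-ow`, so its eigenvalues are
`dw - ow` and `dw + ow`. The bounds on p - q and p + q say that both have nonpositive derivative,
and elimination preserves this. -/
lemma RegularAt.add_two {n : ℕ} {x : ℝ} (h : RegularAt n x) (h' : RegularAt (n + 1) x)
    (hx : pivot n x ≠ 0) : RegularAt (n + 2) x := by
  obtain ⟨p, q, hp, hq, h1, h2⟩ := h.deriv
  obtain ⟨p', q', hp', hq', h1', h2'⟩ := h'.deriv
  have hd : HasDerivAt (pivot n) (1 - 2 * p - 2 * (p' - q')) x :=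
    ((hasDerivAt_id x).sub (hp.const_mul 2)).sub ((hp'.sub hq').const_mul 2)
  have hr := (hq.pow 2).div hd hx
  refine ⟨?_, _, _, (hp.add hr).congr_of_eventuallyEq (.of_forall fun t => dw_add_two n t),
    hr.neg.congr_of_eventuallyEq (.of_forall fun t => ow_add_two n t), ?_, ?_⟩
  · rw [ow_add_two]
    exact neg_ne_zero.2 (div_ne_zero (pow_ne_zero _ h.ow_ne) hx)
  · set s := ow n x / pivot n x with hs
    have e : ow n x = s * pivot n x := by rw [hs]; field_simp
    have : p + ((2:ℕ) * ow n x ^ (2 - 1) * q * pivot n x -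
        (ow n ^ 2) x * (1 - 2 * p - 2 * (p' - q'))) / pivot n x ^ 2
        = p + 2 * s * q - s ^ 2 * (1 - 2 * p - 2 * (p' - q')) := by
      simp only [Pi.pow_apply, e]; field_simp; push_cast; ring
    -- Twice the left side is (p - q)(1 - 2s)² + (p + q)(1 + 2s)² - 4s² + 8s²(p' - q').
    have h3 : p + 4 * s * q - 2 * s ^ 2 * (1 - 2 * p - 2 * (p' - q')) ≤ 0 := by
      nlinarith [mul_nonneg (neg_nonneg.2 h1) (sq_nonneg (1 - 2 * s)),
        mul_nonneg (neg_nonneg.2 h2) (sq_nonneg (1 + 2 * s)), sq_nonneg s,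
        mul_nonneg (neg_nonneg.2 h1') (sq_nonneg s)]
    linarith
  -- The sum `dw + ow` at index n + 2 is just `dw n`, with derivative p, the mean of p - q and p +
  -- q.
  · linarith

lemma regularAt_of_pivot_ne_zero {x : ℝ} :
    ∀ n : ℕ, (∀ j, j + 2 ≤ n → pivot j x ≠ 0) → RegularAt n x
  | 0, _ => ⟨by simp [ow_zero], 0, 0, (hasDerivAt_const x 1).congr_of_eventuallyEq
      (.of_forall dw_zero), (hasDerivAt_const x 1).congr_of_eventuallyEq
      (.of_forall ow_zero), by simp, by simp⟩
  | 1, _ => ⟨by simp [ow_one], 0, 0, (hasDerivAt_const x 1).congr_of_eventuallyEq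
      (.of_forall dw_one), (hasDerivAt_const x 1).congr_of_eventuallyEq
      (.of_forall ow_one), by simp, by simp⟩
  | n + 2, h => (regularAt_of_pivot_ne_zero n fun j hj => h j (by omega)).add_two
      (regularAt_of_pivot_ne_zero (n + 1) fun j hj => h j (by omega)) (h n le_rfl)

/-! ### Orders of zeros and poles -/

/-- `f` behaves like a nonzero multiple of `(t - x) ^ e` as `t` tends to `x`. -/
def HasOrderAt (f : ℝ → ℝ) (e : ℤ) (x : ℝ) : Prop :=
  ∃ a : ℝ, a ≠ 0 ∧ Tendsto (fun t => f t * (t - x) ^ (-e)) (𝓝[≠] x) (𝓝 a)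

lemma eventually_sub_ne_zero (x : ℝ) : ∀ᶠ t in 𝓝[≠] x, t - x ≠ 0 := by
  filter_upwards [self_mem_nhdsWithin] with t ht using sub_ne_zero.2 ht

lemma HasOrderAt.mul {f g : ℝ → ℝ} {d e : ℤ} {x : ℝ} (hf : HasOrderAt f d x)
    (hg : HasOrderAt g e x) : HasOrderAt (fun t => f t * g t) (d + e) x := by
  obtain ⟨a, ha, hfa⟩ := hf
  obtain ⟨b, hb, hgb⟩ := hg
  refine ⟨a * b, mul_ne_zero ha hb, (hfa.mul hgb).congr' ?_⟩
  filter_upwards [eventually_sub_ne_zero x] with t ht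
  rw [neg_add, zpow_add₀ ht]
  ring

/-- Agreement at x itself must not be required: there a vanishing pivot makes the quotients take the
default value 0. -/
lemma HasOrderAt.congr {f g : ℝ → ℝ} {d : ℤ} {x : ℝ} (hf : HasOrderAt f d x)
    (h : ∀ᶠ t in 𝓝[≠] x, f t = g t) : HasOrderAt g d x := by
  obtain ⟨a, ha, hfa⟩ := hf
  refine ⟨a, ha, hfa.congr' ?_⟩
  filter_upwards [h] with t ht
  rw [ht]

lemma HasOrderAt.eventually_ne {f : ℝ → ℝ} {d : ℤ} {x : ℝ} (hf : HasOrderAt f d x) :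
    ∀ᶠ t in 𝓝[≠] x, f t ≠ 0 := by
  obtain ⟨a, ha, hfa⟩ := hf
  filter_upwards [hfa.eventually_ne ha] with t ht h
  simp [h] at ht

lemma HasOrderAt.le {f : ℝ → ℝ} {d e : ℤ} {x : ℝ} (hd : HasOrderAt f d x)
    (he : HasOrderAt f e x) : d ≤ e := by
  obtain ⟨a, ha, hfa⟩ := hd
  obtain ⟨b, hb, hfb⟩ := he
  by_contra! h
  obtain ⟨m, hm⟩ := Int.eq_ofNat_of_zero_le (sub_nonneg.2 h.le)
  have hm0 : m ≠ 0 := by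
    rintro rfl
    have : d - e = 0 := hm
    omega
  have h0 : Tendsto (fun t => (t - x) ^ m) (𝓝[≠] x) (𝓝 0) := by
    have : Tendsto (fun t : ℝ => (t - x) ^ m) (𝓝 x) (𝓝 ((x - x) ^ m)) :=
      (Continuous.tendsto (by fun_prop) x)
    rw [sub_self, zero_pow hm0] at this
    exact this.mono_left nhdsWithin_le_nhds
  have h1 := hfa.mul h0
  rw [mul_zero] at h1
  refine hb (tendsto_nhds_unique hfb (h1.congr' ?_))
  filter_upwards [eventually_sub_ne_zero x] with t ht
  rw [← zpow_natCast (t - x) m, mul_assoc, ← zpow_add₀ ht]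
  congr 2
  have : d - e = m := hm
  omega

lemma HasOrderAt.unique {f : ℝ → ℝ} {d e : ℤ} {x : ℝ} (hd : HasOrderAt f d x)
    (he : HasOrderAt f e x) : d = e :=
  le_antisymm (hd.le he) (he.le hd)

lemma hasOrderAt_zero {f : ℝ → ℝ} {a x : ℝ} (ha : a ≠ 0) (h : Tendsto f (𝓝[≠] x) (𝓝 a)) :
    HasOrderAt f 0 x :=
  ⟨a, ha, by simpa using h⟩

lemma hasOrderAt_neg_one {f : ℝ → ℝ} {a x : ℝ} (ha : a ≠ 0)
    (h : Tendsto (fun t => (t - x) * f t) (𝓝[≠] x) (𝓝 a)) : HasOrderAt f (-1) x :=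
  ⟨a, ha, by simpa [mul_comm] using h⟩

lemma hasOrderAt_rootMultiplicity {f : ℝ[X]} (hf : f ≠ 0) (x : ℝ) :
    HasOrderAt (fun t => f.eval t) (f.rootMultiplicity x) x := by
  obtain ⟨g, hg, hgx⟩ := Polynomial.exists_eq_pow_rootMultiplicity_mul_and_not_dvd f hf x
  rw [dvd_iff_isRoot] at hgx
  refine ⟨g.eval x, hgx, ?_⟩
  refine Tendsto.congr' ?_ ((g.continuous.tendsto x).mono_left nhdsWithin_le_nhds)
  filter_upwards [eventually_sub_ne_zero x] with t ht
  have := congr_arg (eval t) hg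
  simp only [eval_mul, eval_pow, eval_sub, eval_X, eval_C] at this
  rw [this, zpow_neg, zpow_natCast]
  field_simp

/-! ### Pivots after the first zero -/

section FirstZero

variable {x : ℝ}

lemma RegularAt.tendsto_dw {n : ℕ} (h : RegularAt n x) : Tendsto (dw n) (𝓝[≠] x) (𝓝 (dw n x)) := by
  obtain ⟨p, q, hp, hq, -⟩ := h.deriv
  exact hp.continuousAt.tendsto.mono_left nhdsWithin_le_nhds

lemma RegularAt.tendsto_ow {n : ℕ} (h : RegularAt n x) : Tendsto (ow n) (𝓝[≠] x) (𝓝 (ow n x)) := by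
  obtain ⟨p, q, hp, hq, -⟩ := h.deriv
  exact hq.continuousAt.tendsto.mono_left nhdsWithin_le_nhds

lemma tendsto_id_punctured : Tendsto (fun t : ℝ => t) (𝓝[≠] x) (𝓝 x) :=
  tendsto_id.mono_left nhdsWithin_le_nhds

lemma tendsto_sub_punctured : Tendsto (fun t : ℝ => t - x) (𝓝[≠] x) (𝓝 0) := by
  simpa using (tendsto_id_punctured (x := x)).sub_const x

lemma hasOrderAt_pivot_of_regular {n : ℕ} (h : RegularAt n x) (h' : RegularAt (n + 1) x)
    (hx : pivot n x ≠ 0) : HasOrderAt (pivot n) 0 x := by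
  obtain ⟨d, hd, -⟩ := h.hasDerivAt_pivot h'
  exact hasOrderAt_zero hx (hd.continuousAt.tendsto.mono_left nhdsWithin_le_nhds)

lemma tendsto_pivot_div {n : ℕ} (h : RegularAt n x) (h' : RegularAt (n + 1) x)
    (hx : pivot n x = 0) :
    ∃ d : ℝ, 0 < d ∧ Tendsto (fun t => pivot n t / (t - x)) (𝓝[≠] x) (𝓝 d) := by
  obtain ⟨d, hd, hd0⟩ := h.hasDerivAt_pivot h'
  refine ⟨d, hd0, hd.tendsto_slope.congr fun t => ?_⟩
  rw [slope_def_field, hx, sub_zero]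

/-- The behaviour of the weights with index `n` and `n + 1` near `x`, an even and positive number
of steps after the pivot has vanished at `x` for the first time. -/
structure PolarAt (n : ℕ) (x : ℝ) : Prop where
  tendsto : ∃ r u p : ℝ, r ≠ 0 ∧ x - 2 * p - 2 * u ≠ 0 ∧
    Tendsto (fun t => (t - x) * dw n t) (𝓝[≠] x) (𝓝 r) ∧
    Tendsto (fun t => (t - x) * (dw n t ^ 2 - ow n t ^ 2)) (𝓝[≠] x) (𝓝 (2 * r * u)) ∧
    Tendsto (dw (n + 1)) (𝓝[≠] x) (𝓝 p) ∧ Tendsto (ow (n + 1)) (𝓝[≠] x) (𝓝 0)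

/-- In the cases that arise, one of `dw n - ow n`, `dw n + ow n` has a simple pole of residue 2r and
the other tends to u. It is the difference right after the first zero and the sum from then on; the
product `dw² - ow²` treats both cases at once. -/
lemma PolarAt.step {n : ℕ} (h : PolarAt n x) :
    HasOrderAt (pivot n) (-1) x ∧ HasOrderAt (pivot (n + 1)) 0 x ∧ PolarAt (n + 2) x := by
  obtain ⟨r, u, p, hr, hz, hP, hPQ, hP', hQ'⟩ := h.tendsto
  have hε := tendsto_sub_punctured (x := x)
  have hw : Tendsto (fun t => t - 2 * (dw (n + 1) t - ow (n + 1) t)) (𝓝[≠] x)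
      (𝓝 (x - 2 * p)) := by
    simpa using (tendsto_id_punctured (x := x)).sub ((hP'.sub hQ').const_mul 2)
  have hT : Tendsto (fun t => (t - x) * pivot n t) (𝓝[≠] x) (𝓝 (-2 * r)) := by
    have := (hε.mul hw).sub (hP.const_mul 2)
    rw [zero_mul, zero_sub, ← neg_mul] at this
    exact this.congr fun t => by rw [pivot]; ring
  have hr2 : -2 * r ≠ 0 := by simpa using hr
  have hT1 := hasOrderAt_neg_one hr2 hT
  have hQ2 : Tendsto (fun t => (t - x) ^ 2 * ow n t ^ 2) (𝓝[≠] x) (𝓝 (r ^ 2)) := by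
    have := (hP.pow 2).sub (hε.mul hPQ)
    rw [zero_mul, sub_zero] at this
    exact this.congr fun t => by ring
  have hR : Tendsto (fun t => (t - x) * (ow n t ^ 2 / pivot n t)) (𝓝[≠] x) (𝓝 (-(r / 2))) := by
    have := hQ2.div hT hr2
    rw [show r ^ 2 / (-2 * r) = -(r / 2) by field_simp] at this
    refine this.congr' ?_
    filter_upwards [hT1.eventually_ne, eventually_sub_ne_zero x] with t h1 h2
    simp only [Pi.div_apply]
    field_simp
  have hP2 : Tendsto (fun t => (t - x) * dw (n + 2) t) (𝓝[≠] x) (𝓝 (r / 2)) := by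
    have := hP.add hR
    rw [show r + -(r / 2) = r / 2 by ring] at this
    exact this.congr fun t => by rw [dw_add_two]; ring
  have hU : Tendsto (fun t => dw (n + 2) t - ow (n + 2) t) (𝓝[≠] x)
      (𝓝 (2 * u - (x - 2 * p) / 2)) := by
    -- Over the denominator `pivot n` the numerator is dw·w - 2(dw² - ow²), where w = t - 2(dw' -
    -- ow') with weights of index n + 1. It has only a simple pole, which the pole of the pivot
    -- cancels.
    have := ((hP.mul hw).sub (hPQ.const_mul 2)).div hT hr2
    rw [show (r * (x - 2 * p) - 2 * (2 * r * u)) / (-2 * r) = 2 * u - (x - 2 * p) / 2 by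
      field_simp; ring] at this
    refine this.congr' ?_
    filter_upwards [hT1.eventually_ne, eventually_sub_ne_zero x] with t h1 h2
    simp only [Pi.div_apply]
    rw [dw_add_two, ow_add_two]
    field_simp
    rw [pivot]
    ring
  -- This quantity is twice x - 2p - 2u, so it never becomes zero.
  have hz2 : x - 2 * p - 2 * (2 * u - (x - 2 * p) / 2) ≠ 0 := by
    intro h0
    exact hz (by linarith)
  have hT' : Tendsto (pivot (n + 1)) (𝓝[≠] x)
      (𝓝 (x - 2 * p - 2 * (2 * u - (x - 2 * p) / 2))) :=
    ((tendsto_id_punctured (x := x)).sub (hP'.const_mul 2)).sub (hU.const_mul 2)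
  have hR' : Tendsto (fun t => ow (n + 1) t ^ 2 / pivot (n + 1) t) (𝓝[≠] x) (𝓝 0) := by
    have := (hQ'.pow 2).div hT' hz2
    rw [zero_pow two_ne_zero, zero_div] at this
    exact this
  refine ⟨hT1, hasOrderAt_zero hz2 hT', ⟨r / 2, _, p, by simpa using hr, hz2, hP2, ?_, ?_, ?_⟩⟩
  · have := hU.mul hP
    rw [show 2 * (r / 2) * (2 * u - (x - 2 * p) / 2) = (2 * u - (x - 2 * p) / 2) * r by ring]
    refine this.congr fun t => ?_
    rw [dw_add_two, ow_add_two]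
    ring
  · have := hP'.add hR'
    rw [add_zero] at this
    exact this.congr fun t => (dw_add_two (n + 1) t).symm
  · have := hR'.neg
    rw [neg_zero] at this
    exact this.congr fun t => (ow_add_two (n + 1) t).symm

/-- The simple zero of the pivot gives `dw` and `ow` opposite residues: they add up in `dw - ow`,
while `dw + ow` stays equal to the regular function `dw n`. -/
lemma polarAt_add_two {n : ℕ} (h : RegularAt n x) (h' : RegularAt (n + 1) x)
    (hx : pivot n x = 0) :
    HasOrderAt (pivot n) 1 x ∧ HasOrderAt (pivot (n + 1)) (-1) x ∧ PolarAt (n + 2) x := by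
  obtain ⟨d, hd0, hd⟩ := tendsto_pivot_div h h' hx
  have hε := tendsto_sub_punctured (x := x)
  have hT : HasOrderAt (pivot n) 1 x :=
    ⟨d, hd0.ne', hd.congr fun t => by rw [zpow_neg_one, div_eq_mul_inv]⟩
  set r := ow n x ^ 2 / d with hrdef
  have hr : r ≠ 0 := div_ne_zero (pow_ne_zero _ h.ow_ne) hd0.ne'
  have hR : Tendsto (fun t => (t - x) * (ow n t ^ 2 / pivot n t)) (𝓝[≠] x) (𝓝 r) := by
    refine ((h.tendsto_ow.pow 2).div hd hd0.ne').congr' ?_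
    filter_upwards [hT.eventually_ne, eventually_sub_ne_zero x] with t h1 h2
    simp only [Pi.div_apply]
    field_simp
  have hP2 : Tendsto (fun t => (t - x) * dw (n + 2) t) (𝓝[≠] x) (𝓝 r) := by
    have := (hε.mul h.tendsto_dw).add hR
    rw [zero_mul, zero_add] at this
    exact this.congr fun t => by rw [dw_add_two]; ring
  have hU : Tendsto (fun t => (t - x) * (dw (n + 2) t - ow (n + 2) t)) (𝓝[≠] x) (𝓝 (2 * r)) := by
    have := (hε.mul h.tendsto_dw).add (hR.const_mul 2)
    rw [zero_mul, zero_add] at this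
    exact this.congr fun t => by rw [dw_add_two, ow_add_two]; ring
  have hT' : Tendsto (fun t => (t - x) * pivot (n + 1) t) (𝓝[≠] x) (𝓝 (-4 * r)) := by
    have := (hε.mul ((tendsto_id_punctured (x := x)).sub (h'.tendsto_dw.const_mul 2))).sub
      (hU.const_mul 2)
    rw [show 0 * (x - 2 * dw (n + 1) x) - 2 * (2 * r) = -4 * r by ring] at this
    exact this.congr fun t => by rw [pivot]; ring
  have hr4 : -4 * r ≠ 0 := by simpa using hr
  have hT1 := hasOrderAt_neg_one hr4 hT'
  have hR' : Tendsto (fun t => ow (n + 1) t ^ 2 / pivot (n + 1) t) (𝓝[≠] x) (𝓝 0) := by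
    have := (hε.mul (h'.tendsto_ow.pow 2)).div hT' hr4
    rw [zero_mul, zero_div] at this
    refine this.congr' ?_
    filter_upwards [hT1.eventually_ne, eventually_sub_ne_zero x] with t h1 h2
    simp only [Pi.div_apply]
    field_simp
  refine ⟨hT, hT1, ⟨r, dw n x, dw (n + 1) x, hr, ?_, hP2, ?_, ?_, ?_⟩⟩
  -- Since `pivot n x = 0`, the quantity x - 2p - 2u equals `-2 * ow (n + 1) x`.
  · intro h0
    rw [pivot] at hx
    exact h'.ow_ne (by linarith)
  · refine (hU.mul h.tendsto_dw).congr fun t => ?_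
    rw [dw_add_two, ow_add_two]
    ring
  · have := h'.tendsto_dw.add hR'
    rw [add_zero] at this
    exact this.congr fun t => (dw_add_two (n + 1) t).symm
  · have := hR'.neg
    rw [neg_zero] at this
    exact this.congr fun t => (ow_add_two (n + 1) t).symm

/-- The order of the pivot, `m` steps after the pivot has vanished for the first time. -/
def pivotOrder : ℕ → ℤ
  | 0 => 1
  | 1 => -1
  | 2 => -1
  | 3 => 0
  | m + 4 => pivotOrder (m + 2)

lemma hasOrderAt_pivot_add {k : ℕ} (hlt : ∀ j < k, pivot j x ≠ 0) (hk : pivot k x = 0) (m : ℕ) :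
    HasOrderAt (pivot (k + m)) (pivotOrder m) x := by
  obtain ⟨h0, h1, h2⟩ := polarAt_add_two (regularAt_of_pivot_ne_zero k fun j hj => hlt j (by omega))
    (regularAt_of_pivot_ne_zero (k + 1) fun j hj => hlt j (by omega)) hk
  have hp : ∀ i, PolarAt (k + 2 + 2 * i) x := by
    intro i
    induction i with
    | zero => exact h2
    | succ i ih => exact ih.step.2.2
  have ho : ∀ i, pivotOrder (2 + 2 * i) = -1 ∧ pivotOrder (3 + 2 * i) = 0 := by
    intro i
    induction i with
    | zero => simp [pivotOrder]
    | succ i ih =>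
      rw [show 2 + 2 * (i + 1) = 2 * i + 4 by ring, show 3 + 2 * (i + 1) = (2 * i + 1) + 4 by ring,
        pivotOrder, pivotOrder, show 2 * i + 2 = 2 + 2 * i by ring,
        show 2 * i + 1 + 2 = 3 + 2 * i by ring]
      exact ih
  match m with
  | 0 => exact h0
  | 1 => exact h1
  | m + 2 =>
    obtain ⟨i, rfl | rfl⟩ := Nat.even_or_odd' m
    · rw [show 2 * i + 2 = 2 + 2 * i by ring, (ho i).1, ← add_assoc]
      exact (hp i).step.1
    · rw [show 2 * i + 1 + 2 = 3 + 2 * i by ring, (ho i).2,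
        show k + (3 + 2 * i) = k + 2 + 2 * i + 1 by ring]
      exact (hp i).step.2.1

end FirstZero


/-! ### Elimination of the new vertices -/

namespace EdgeLabelledGraph

variable (G : EdgeLabelledGraph)

/-- The contribution of an edge with diagonal weight `p` and off-diagonal weight `q` to the
Laplacian. -/
def edgeTerm {V : Type} [DecidableEq V] (p q : ℝ) (v : Bool → V) (x y : V) : ℝ :=
  ∑ i : Bool, ((if v i = x ∧ x = y then p else 0) - if v i = x ∧ v (!i) = y then q else 0)

/-- The matrix `t - L`, where `L` is the Laplacian in which the `a`-edges carry the weights `pa`,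
`qa` and the `b`-edges the weights `pb`, `qb`. -/
def weightedMatrix (pa qa pb qb t : ℝ) : Matrix G.V G.V ℝ := fun x y =>
  (if x = y then t else 0) - ∑ e : G.A, edgeTerm pa qa (G.aEnd e) x y
    - ∑ e : G.B, edgeTerm pb qb (G.bEnd e) x y

/-- The restriction of the weighted matrix to the interior. -/
def interiorMatrix (pa qa pb qb t : ℝ) : Matrix G.Interior G.Interior ℝ :=
  (G.weightedMatrix pa qa pb qb t).submatrix Subtype.val Subtype.val

/-- The interior of the replaced graph consists of the old interior and the new vertices. -/
def interiorReplaceEquiv : G.Interior ⊕ G.A ≃ G.replace.Interior where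
  toFun := Sum.elim (fun x => ⟨Sum.inl x.1, fun i h => x.2 i (Sum.inl_injective h)⟩)
    fun e => ⟨Sum.inr e, fun _ h => Sum.inr_ne_inl h⟩
  invFun := fun x => match x with
    | ⟨Sum.inl x, h⟩ => Sum.inl ⟨x, fun i hi => h i (congr_arg Sum.inl hi)⟩
    | ⟨Sum.inr e, _⟩ => Sum.inr e
  left_inv := by rintro (x | e) <;> rfl
  right_inv := by rintro ⟨x | e, h⟩ <;> rfl

lemma weightedMatrix_replace_inr_inr (pa qa pb qb t : ℝ) (e e' : G.A) :
    G.replace.weightedMatrix pa qa pb qb t (Sum.inr e) (Sum.inr e') =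
      if e = e' then t - 2 * pb - 2 * (pa - qa) else 0 := by
  change (if (Sum.inr e : G.V ⊕ G.A) = Sum.inr e' then t else 0)
    - ∑ d : G.B ⊕ G.A, edgeTerm pa qa (Sum.elim (fun e i => Sum.inl (G.bEnd e i))
      (fun e _ => Sum.inr e) d) (Sum.inr e : G.V ⊕ G.A) (Sum.inr e')
    - ∑ d : G.A × Bool, edgeTerm pb qb (fun i => bif i then Sum.inr d.1 else
      Sum.inl (G.aEnd d.1 d.2)) (Sum.inr e : G.V ⊕ G.A) (Sum.inr e') = _
  simp only [Fintype.sum_sum_type, Fintype.sum_prod_type, edgeTerm]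
  by_cases h : e = e'
  · subst h
    simp [Finset.sum_ite_eq', Finset.sum_sub_distrib]
    ring
  · simp [h, ite_and]

lemma weightedMatrix_replace_inl_inr (pa qa pb qb t : ℝ) (x : G.V) (e : G.A) :
    G.replace.weightedMatrix pa qa pb qb t (Sum.inl x) (Sum.inr e) =
      ∑ i : Bool, if G.aEnd e i = x then qb else 0 := by
  change (if (Sum.inl x : G.V ⊕ G.A) = Sum.inr e then t else 0)
    - ∑ d : G.B ⊕ G.A, edgeTerm pa qa (Sum.elim (fun e i => Sum.inl (G.bEnd e i))
      (fun e _ => Sum.inr e) d) (Sum.inl x : G.V ⊕ G.A) (Sum.inr e)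
    - ∑ d : G.A × Bool, edgeTerm pb qb (fun i => bif i then Sum.inr d.1 else
      Sum.inl (G.aEnd d.1 d.2)) (Sum.inl x : G.V ⊕ G.A) (Sum.inr e) = _
  simp only [Fintype.sum_sum_type, Fintype.sum_prod_type, edgeTerm]
  simp only [Fintype.sum_bool, Finset.sum_add_distrib]
  simp [ite_and, add_comm]
  congr 1 <;> rw [Finset.sum_eq_single e] <;> simp +contextual

lemma weightedMatrix_replace_inr_inl (pa qa pb qb t : ℝ) (x : G.V) (e : G.A) :
    G.replace.weightedMatrix pa qa pb qb t (Sum.inr e) (Sum.inl x) =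
      ∑ i : Bool, if G.aEnd e i = x then qb else 0 := by
  change (if (Sum.inr e : G.V ⊕ G.A) = Sum.inl x then t else 0)
    - ∑ d : G.B ⊕ G.A, edgeTerm pa qa (Sum.elim (fun e i => Sum.inl (G.bEnd e i))
      (fun e _ => Sum.inr e) d) (Sum.inr e : G.V ⊕ G.A) (Sum.inl x)
    - ∑ d : G.A × Bool, edgeTerm pb qb (fun i => bif i then Sum.inr d.1 else
      Sum.inl (G.aEnd d.1 d.2)) (Sum.inr e : G.V ⊕ G.A) (Sum.inl x) = _
  simp only [Fintype.sum_sum_type, Fintype.sum_prod_type, edgeTerm]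
  simp [ite_and, add_comm]

lemma weightedMatrix_replace_inl_inl (pa qa pb qb t : ℝ) (x y : G.V) :
    G.replace.weightedMatrix pa qa pb qb t (Sum.inl x) (Sum.inl y) =
      (if x = y then t else 0) - ∑ e : G.B, edgeTerm pa qa (G.bEnd e) x y -
        ∑ e : G.A, ∑ i : Bool, if G.aEnd e i = x ∧ x = y then pb else 0 := by
  change (if (Sum.inl x : G.V ⊕ G.A) = Sum.inl y then t else 0)
    - ∑ d : G.B ⊕ G.A, edgeTerm pa qa (Sum.elim (fun e i => Sum.inl (G.bEnd e i))
      (fun e _ => Sum.inr e) d) (Sum.inl x : G.V ⊕ G.A) (Sum.inl y)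
    - ∑ d : G.A × Bool, edgeTerm pb qb (fun i => bif i then Sum.inr d.1 else
      Sum.inl (G.aEnd d.1 d.2)) (Sum.inl x : G.V ⊕ G.A) (Sum.inl y) = _
  simp only [Fintype.sum_sum_type, Fintype.sum_prod_type, edgeTerm]
  simp

/-- An eliminated vertex causes a rank-one update supported on the two ends of its edge, which is
again an edge term, also when the edge is a loop. The new off-diagonal weight is negative because t
- L has entries +q where the Laplacian has -q. -/
lemma edgeTerm_schur {V : Type} [DecidableEq V] (p q d : ℝ) (v : Bool → V) (x y : V) :
    (∑ i : Bool, if v i = x ∧ x = y then p else 0) +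
        (∑ i : Bool, if v i = x then q else 0) * d⁻¹ * (∑ i : Bool, if v i = y then q else 0) =
      edgeTerm (p + q ^ 2 / d) (-(q ^ 2 / d)) v x y := by
  simp only [edgeTerm, Fintype.sum_bool, Bool.not_true, Bool.not_false]
  by_cases hxy : x = y
  · subst hxy
    by_cases h1 : v true = x <;> by_cases h2 : v false = x <;> simp [h1, h2] <;> ring
  · by_cases h1 : v true = x <;> by_cases h2 : v false = x <;> by_cases h3 : v true = y <;>
      by_cases h4 : v false = y <;> simp_all <;> ring

/-- Old `b`-edges survive as `a`-edges of the replaced graph, so after elimination `pa`, `qa` become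
the weights of the `b`-edges. -/
lemma det_interiorMatrix_replace (pa qa pb qb t : ℝ) (h : t - 2 * pb - 2 * (pa - qa) ≠ 0) :
    (G.replace.interiorMatrix pa qa pb qb t).det =
      (t - 2 * pb - 2 * (pa - qa)) ^ Fintype.card G.A *
        (G.interiorMatrix (pb + qb ^ 2 / (t - 2 * pb - 2 * (pa - qa)))
          (-(qb ^ 2 / (t - 2 * pb - 2 * (pa - qa)))) pa qa t).det := by
  set d := t - 2 * pb - 2 * (pa - qa) with hd
  rw [← Matrix.det_submatrix_equiv_self G.interiorReplaceEquiv]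
  let N : Matrix G.Interior G.A ℝ := fun x e => ∑ i : Bool, if G.aEnd e i = x.1 then qb else 0
  let K : Matrix G.Interior G.Interior ℝ := fun x y =>
    G.replace.weightedMatrix pa qa pb qb t (Sum.inl x.1) (Sum.inl y.1)
  have hM : (G.replace.interiorMatrix pa qa pb qb t).submatrix G.interiorReplaceEquiv
      G.interiorReplaceEquiv = Matrix.fromBlocks K N N.transpose (Matrix.diagonal fun _ => d) := by
    ext (x | e) (y | e')
    · rfl
    · exact G.weightedMatrix_replace_inl_inr pa qa pb qb t x.1 e'
    · exact G.weightedMatrix_replace_inr_inl pa qa pb qb t y.1 e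
    · rw [Matrix.fromBlocks_apply₂₂, Matrix.diagonal_apply]
      exact G.weightedMatrix_replace_inr_inr pa qa pb qb t e e'
  let I : Invertible (Matrix.diagonal fun _ : G.A => d) :=
    ⟨Matrix.diagonal fun _ => d⁻¹, by simp [h], by simp [h]⟩
  rw [hM, Matrix.det_fromBlocks₂₂, Matrix.det_diagonal, Finset.prod_const, Finset.card_univ]
  congr 2
  ext x y
  change K x y - (N * (Matrix.diagonal fun _ : G.A => d⁻¹ : Matrix G.A G.A ℝ) * N.transpose :
    Matrix G.Interior G.Interior ℝ) x y = _
  rw [Matrix.mul_apply]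
  simp only [Matrix.mul_diagonal, Matrix.transpose_apply]
  simp only [K, N, interiorMatrix, Matrix.submatrix_apply, weightedMatrix_replace_inl_inl]
  simp only [weightedMatrix, ← edgeTerm_schur, Finset.sum_add_distrib]
  ring

/-! ### Symmetry and the characteristic polynomial -/

lemma edgeTerm_comm {V : Type} [DecidableEq V] (p q : ℝ) (v : Bool → V) (x y : V) :
    edgeTerm p q v x y = edgeTerm p q v y x := by
  simp only [edgeTerm, Fintype.sum_bool, Bool.not_true, Bool.not_false]
  by_cases hxy : x = y
  · rw [hxy]
  · by_cases h1 : v true = x <;> by_cases h2 : v false = x <;> by_cases h3 : v true = y <;>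
      by_cases h4 : v false = y <;> simp_all

lemma interiorMatrix_isSymm (pa qa pb qb t : ℝ) : (G.interiorMatrix pa qa pb qb t).IsSymm := by
  ext x y
  simp only [interiorMatrix, weightedMatrix, Matrix.transpose_apply, Matrix.submatrix_apply,
    edgeTerm_comm _ _ _ y.1 x.1, eq_comm (a := y.1)]

/-- A loop is counted once on the left and twice on the right, but contributes f x - f x = 0 either
way. -/
lemma sum_ends_eq {V : Type} [Fintype V] [DecidableEq V] (v : Bool → V) (f : V → ℝ) (x : V) :
    ∑ y, (if s(v false, v true) = s(x, y) then f x - f y else 0) =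
      ∑ i : Bool, if v i = x then f x - f (v !i) else 0 := by
  simp only [Fintype.sum_bool, Bool.not_true, Bool.not_false, Sym2.eq_iff]
  by_cases h1 : v true = x <;> by_cases h2 : v false = x
  · simp only [h1, h2, true_and, and_true, or_self, sub_self, if_true, add_zero]
    exact Finset.sum_eq_zero fun y _ => by split_ifs with h <;> simp [h]
  · simp [h1, h2]
  · simp [h1, h2]
  · simp [h1, h2]

lemma laplacian_apply_eq (f : G.V → ℝ) (x : G.V) :
    G.laplacian f x = (∑ e : G.A, ∑ i : Bool, if G.aEnd e i = x then f x - f (G.aEnd e !i) else 0) +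
      ∑ e : G.B, ∑ i : Bool, if G.bEnd e i = x then f x - f (G.bEnd e !i) else 0 := by
  simp only [← sum_ends_eq]
  rw [Finset.sum_comm, Finset.sum_comm (s := Finset.univ (α := G.B)), ← Finset.sum_add_distrib]
  change ∑ y, (G.edgeCount x y : ℝ) * (f x - f y) = _
  refine Finset.sum_congr rfl fun y _ => ?_
  rw [edgeCount, Fintype.card_subtype, Fintype.card_subtype, ← Finset.sum_filter,
    ← Finset.sum_filter, Finset.sum_const, Finset.sum_const]
  push_cast
  simp only [nsmul_eq_mul]
  ring

lemma toMatrix'_dirichletLaplacian (t : ℝ) :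
    LinearMap.toMatrix' (algebraMap ℝ (Module.End ℝ (G.Interior → ℝ)) t - G.dirichletLaplacian) =
      G.interiorMatrix 1 1 1 1 t := by
  ext x y
  have hext : Function.ExtendByZero.linearMap ℝ (Subtype.val : G.Interior → G.V)
      (Pi.single y 1) = Pi.single y.1 1 := by
    ext z
    change Function.extend Subtype.val (Pi.single y (1 : ℝ)) 0 z = _
    by_cases hz : ∀ i, z ≠ G.bdry i
    · have := Subtype.val_injective.extend_apply (Pi.single y (1 : ℝ)) 0 (⟨z, hz⟩ : G.Interior)
      rw [this]
      simp [Pi.single_apply, Subtype.ext_iff]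
    · rw [Function.extend_apply']
      · rw [Pi.single_eq_of_ne]
        · rfl
        · rintro rfl
          exact hz y.2
      · rintro ⟨w, rfl⟩
        exact hz w.2
  rw [LinearMap.toMatrix'_apply]
  change t * (Pi.single y (1 : ℝ) : G.Interior → ℝ) x - G.laplacian
    (Function.ExtendByZero.linearMap ℝ (Subtype.val : G.Interior → G.V) (Pi.single y 1)) x.1 = _
  rw [hext, laplacian_apply_eq, ← sub_sub]
  have hterm : ∀ v : Bool → G.V, (∑ i : Bool, if v i = x.1 then
      (Pi.single y.1 (1 : ℝ) : G.V → ℝ) x.1 - (Pi.single y.1 (1 : ℝ) : G.V → ℝ) (v !i) else 0) =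
      edgeTerm 1 1 v x.1 y.1 := fun v => by
    refine Finset.sum_congr rfl fun i _ => ?_
    by_cases h : v i = x.1 <;> simp [h, Pi.single_apply]
  simp only [hterm, interiorMatrix, weightedMatrix, Matrix.submatrix_apply]
  congr 2
  simp [Pi.single_apply, Subtype.ext_iff]

lemma eval_charpoly_dirichletLaplacian (t : ℝ) :
    (G.dirichletLaplacian.charpoly).eval t = (G.interiorMatrix 1 1 1 1 t).det := by
  rw [LinearMap.eval_charpoly, ← LinearMap.det_toMatrix', toMatrix'_dirichletLaplacian]

/-- The Dirichlet Laplacian is symmetric. -/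
lemma toMatrix'_dirichletLaplacian_isSymm :
    (LinearMap.toMatrix' G.dirichletLaplacian).IsSymm := by
  have := G.toMatrix'_dirichletLaplacian 0
  rw [map_zero, zero_sub, map_neg, neg_eq_iff_eq_neg] at this
  rw [this]
  exact (G.interiorMatrix_isSymm 1 1 1 1 0).neg

lemma splits_charpoly_dirichletLaplacian : G.dirichletLaplacian.charpoly.Splits := by
  rw [← LinearMap.charpoly_toMatrix _ (Pi.basisFun ℝ G.Interior)]
  refine Matrix.IsHermitian.splits_charpoly (𝕜 := ℝ) ?_
  rw [Matrix.IsHermitian, Matrix.conjTranspose_eq_transpose_of_trivial]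
  exact G.toMatrix'_dirichletLaplacian_isSymm

open Matrix in
lemma dirichletLaplacian_dotProduct (f g : G.Interior → ℝ) :
    G.dirichletLaplacian f ⬝ᵥ g = f ⬝ᵥ G.dirichletLaplacian g := by
  have h : ∀ f, G.dirichletLaplacian f = LinearMap.toMatrix' G.dirichletLaplacian *ᵥ f :=
    fun f => (LinearMap.toMatrix'_mulVec _ f).symm
  rw [h, h, Matrix.dotProduct_mulVec, ← Matrix.mulVec_transpose,
    G.toMatrix'_dirichletLaplacian_isSymm.eq]

open Matrix in
lemma maxGenEigenspace_dirichletLaplacian (x : ℝ) :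
    G.dirichletLaplacian.maxGenEigenspace x = G.dirichletLaplacian.eigenspace x := by
  refine le_antisymm (fun v hv => ?_) ((G.dirichletLaplacian.genEigenspace x).mono le_top)
  obtain ⟨n, hn⟩ := Module.End.mem_maxGenEigenspace _ _ _ |>.1 hv
  set g := G.dirichletLaplacian - x • 1 with hg
  have hsymm : ∀ u w, g u ⬝ᵥ w = u ⬝ᵥ g w := fun u w => by
    simp [hg, sub_dotProduct, dotProduct_sub, dirichletLaplacian_dotProduct]
  -- Symmetry gives g u · g u = u · g (g u) = 0, so no Jordan block is longer than 1.
  have hker : ∀ u, g (g u) = 0 → g u = 0 := fun u hu => by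
    rw [← dotProduct_self_eq_zero, hsymm, hu, dotProduct_zero]
  rw [Module.End.mem_eigenspace_iff, ← sub_eq_zero]
  change g v = 0
  induction n with
  | zero =>
    have : v = 0 := by simpa using hn
    rw [this, map_zero]
  | succ n ih =>
    cases n with
    | zero => simpa using hn
    | succ n =>
      refine ih ?_
      rw [pow_succ', pow_succ', Module.End.mul_apply, Module.End.mul_apply] at hn
      rw [pow_succ', Module.End.mul_apply]
      exact hker _ hn

lemma finrank_eigenspace_dirichletLaplacian (x : ℝ) :
    Module.finrank ℝ (G.dirichletLaplacian.eigenspace x) =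
      G.dirichletLaplacian.charpoly.rootMultiplicity x := by
  rw [← maxGenEigenspace_dirichletLaplacian, LinearMap.finrank_maxGenEigenspace_eq]

end EdgeLabelledGraph

/-! ### Counting, and the product formula for c_n -/

lemma card_A_replace (G : EdgeLabelledGraph) :
    Fintype.card G.replace.A = Fintype.card G.A + Fintype.card G.B := by
  rw [add_comm]
  exact Fintype.card_sum

lemma card_B_replace (G : EdgeLabelledGraph) :
    Fintype.card G.replace.B = 2 * Fintype.card G.A := by
  rw [mul_comm]
  exact (Fintype.card_prod G.A Bool).trans (by simp)

/-- The number of `a`-edges of `G_n`. -/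
def numA (n : ℕ) : ℕ := Fintype.card (graph n).A

lemma numA_zero : numA 0 = 1 := rfl

lemma numA_one : numA 1 = 1 := rfl

lemma numA_add_two (n : ℕ) : numA (n + 2) = numA (n + 1) + 2 * numA n := by
  rw [numA, graph, card_A_replace, graph, card_B_replace]
  rfl

/-- The number of interior vertices of `G_n`. -/
def numV (n : ℕ) : ℕ := Fintype.card (graph n).Interior

lemma numV_zero : numV 0 = 0 := by
  rw [numV, Fintype.card_eq_zero_iff]
  exact ⟨fun x => x.2 x.1 rfl⟩

lemma numV_succ (n : ℕ) : numV (n + 1) = numV n + numA n := by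
  rw [numV, graph, ← Fintype.card_congr (graph n).interiorReplaceEquiv, Fintype.card_sum]
  rfl

/-- The extra 1 is what later forces a new eigenvalue at every level. -/
lemma numV_add_two (n : ℕ) : numV (n + 2) = numV (n + 1) + 2 * numV n + 1 := by
  induction n with
  | zero => simp [numV_succ, numV_zero, numA_zero, numA_one]
  | succ n ih =>
    have h1 := numA_add_two n
    have h2 : numV (n + 3) = _ := numV_succ (n + 2)
    have h3 : numV (n + 2) = _ := numV_succ (n + 1)
    have h4 := numV_succ n
    change numV (n + 3) = numV (n + 2) + 2 * numV (n + 1) + 1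
    omega

lemma natDegree_c (n : ℕ) : (c n).natDegree = numV n := by
  rw [c, LinearMap.charpoly_natDegree, Module.finrank_fintype_fun_eq_card, numV]

lemma c_monic (n : ℕ) : (c n).Monic := LinearMap.charpoly_monic _

/-- The shift j is needed for the induction, since each elimination raises the weight indices by
one. The i-th elimination removes one vertex for each `a`-edge of `graph (n - 1 - i)`. -/
lemma det_interiorMatrix_graph (t : ℝ) (n : ℕ) : ∀ j, (∀ i < n, pivot (j + i) t ≠ 0) →
    ((graph n).interiorMatrix (dw (j + 1) t) (ow (j + 1) t) (dw j t) (ow j t) t).det =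
      ∏ i ∈ Finset.range n, pivot (j + i) t ^ numA (n - 1 - i) := by
  induction n with
  | zero =>
    intro j _
    have : IsEmpty (graph 0).Interior := Fintype.card_eq_zero_iff.1 numV_zero
    rw [Matrix.det_isEmpty, Finset.prod_range_zero]
  | succ n ih =>
    intro j h
    have h0 : pivot j t ≠ 0 := h 0 n.succ_pos
    rw [graph, EdgeLabelledGraph.det_interiorMatrix_replace _ _ _ _ _ _ h0,
      Finset.prod_range_succ']
    change pivot j t ^ numA n * ((graph n).interiorMatrix (dw j t + ow j t ^ 2 / pivot j t)
      (-(ow j t ^ 2 / pivot j t)) _ _ t).det = _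
    rw [← dw_add_two, ← ow_add_two, ih (j + 1) fun i hi => by
      rw [show j + 1 + i = j + (i + 1) by ring]; exact h (i + 1) (by omega), mul_comm]
    refine congr_arg₂ _ (Finset.prod_congr rfl fun i hi => ?_) rfl
    rw [show j + 1 + i = j + (i + 1) by ring, show n + 1 - 1 - (i + 1) = n - 1 - i by omega]

lemma eval_c {t : ℝ} {n : ℕ} (h : ∀ i < n, pivot i t ≠ 0) :
    (c n).eval t = ∏ i ∈ Finset.range n, pivot i t ^ numA (n - 1 - i) := by
  have := det_interiorMatrix_graph t n 0 (by simpa using h)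
  simp only [zero_add, dw_zero, ow_zero, dw_one, ow_one] at this
  rw [← this]
  exact (graph n).eval_charpoly_dirichletLaplacian t

/-! ### The multiplicity sequence -/

/-- The Jacobsthal numbers. -/
def jacobsthal : ℕ → ℕ
  | 0 => 0
  | 1 => 1
  | n + 2 => jacobsthal (n + 1) + 2 * jacobsthal n

/-- The multiplicity of an eigenvalue, `m` levels after its first occurrence. -/
def mult : ℕ → ℕ
  | 0 => 1
  | 1 => 0
  | m + 2 => mult m + jacobsthal m

lemma jacobsthal_eq (m : ℕ) : (jacobsthal m : ℚ) = (2 ^ m - (-1) ^ m) / 3 := by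
  induction m using Nat.twoStepInduction with
  | zero => norm_num [jacobsthal]
  | one => norm_num [jacobsthal]
  | more m h1 h2 =>
    rw [jacobsthal]
    push_cast
    rw [h1, h2]
    ring

lemma mult_eq (m : ℕ) : (mult m : ℚ) =
    (9 + 23 * (-1) ^ m + 2 ^ (m + 2) - 6 * (m : ℚ) * (-1) ^ m) / 36 := by
  induction m using Nat.twoStepInduction with
  | zero => norm_num [mult]
  | one => norm_num [mult]
  | more m h1 h2 =>
    rw [mult]
    push_cast
    rw [h1, jacobsthal_eq]
    ring

/-- Subtract the instances for m and m + 2: the increments of `mult` are Jacobsthal numbers, which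
satisfy the homogeneous recursion, and `pivotOrder` has period 2 from index 2 on. -/
lemma mult_add_two : ∀ m : ℕ, (mult (m + 2) : ℤ) = mult (m + 1) + 2 * mult m + pivotOrder (m + 2)
  | 0 => rfl
  | 1 => rfl
  | m + 2 => by
    have h := mult_add_two m
    have h4 : mult (m + 4) = mult (m + 2) + jacobsthal (m + 2) := rfl
    have h3 : mult (m + 3) = mult (m + 1) + jacobsthal (m + 1) := rfl
    have h2 : mult (m + 2) = mult m + jacobsthal m := rfl
    have hj : jacobsthal (m + 2) = jacobsthal (m + 1) + 2 * jacobsthal m := rfl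
    have hp : pivotOrder (m + 4) = pivotOrder (m + 2) := rfl
    change (mult (m + 4) : ℤ) = mult (m + 3) + 2 * mult (m + 2) + pivotOrder (m + 4)
    omega

lemma mult_add_two_le (m : ℕ) : mult (m + 2) ≤ mult (m + 1) + 2 * mult m := by
  have h := mult_add_two m
  have hp : ∀ m, pivotOrder (m + 2) ≤ 0 := fun m => by
    induction m using Nat.twoStepInduction with
    | zero => simp [pivotOrder]
    | one => simp [pivotOrder]
    | more m h1 h2 => exact h1
  have := hp m
  omega

/-! ### Multiplicities of the roots of c_n -/

lemma eval_c_add_two {t : ℝ} {n : ℕ} (h : ∀ i < n + 2, pivot i t ≠ 0) :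
    (c (n + 2)).eval t = (c (n + 1)).eval t * (c n).eval t ^ 2 * pivot (n + 1) t := by
  rw [eval_c h, eval_c fun i hi => h i (by omega), eval_c fun i hi => h i (by omega),
    Finset.prod_range_succ, Finset.prod_range_succ, Finset.prod_range_succ, ← Finset.prod_pow]
  have key : ∏ i ∈ Finset.range n, pivot i t ^ numA (n + 2 - 1 - i) =
      (∏ i ∈ Finset.range n, pivot i t ^ numA (n + 1 - 1 - i)) *
        ∏ i ∈ Finset.range n, (pivot i t ^ numA (n - 1 - i)) ^ 2 := by
    rw [← Finset.prod_mul_distrib]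
    refine Finset.prod_congr rfl fun i hi => ?_
    obtain ⟨d, rfl⟩ := Nat.exists_eq_add_of_lt (Finset.mem_range.1 hi)
    rw [show i + d + 1 + 2 - 1 - i = d + 2 by omega, show i + d + 1 + 1 - 1 - i = d + 1 by omega,
      show i + d + 1 - 1 - i = d by omega, numA_add_two, pow_add, pow_mul']
  -- The recursion for `numA` does not reach the last factors. Pivot n has exponent `numA 1 = numA 0
  -- = 1` in both c_{n+2} and c_{n+1}, which leaves pivot n + 1 as the extra factor.
  rw [key, show n + 2 - 1 - n = 1 by omega, show n + 2 - 1 - (n + 1) = 0 by omega,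
    show n + 1 - 1 - n = 0 by omega, numA_one, numA_zero, pow_one, pow_one]
  ring

lemma rootMultiplicity_c_zero (x : ℝ) : (c 0).rootMultiplicity x = 0 := by
  have := natDegree_c 0
  rw [numV_zero] at this
  rw [(c_monic 0).natDegree_eq_zero.1 this]
  simp

lemma rootMultiplicity_c_one {x : ℝ} {e : ℤ} (h : HasOrderAt (pivot 0) e x) :
    ((c 1).rootMultiplicity x : ℤ) = e := by
  refine (hasOrderAt_rootMultiplicity (c_monic 1).ne_zero x).unique (h.congr ?_)
  filter_upwards [h.eventually_ne] with t ht
  rw [eval_c (n := 1) fun i hi => by rwa [Nat.lt_one_iff.1 hi]]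
  simp [numA_zero]

lemma rootMultiplicity_c_add_two {x : ℝ} {n : ℕ} {e : ℕ → ℤ}
    (h : ∀ i < n + 2, HasOrderAt (pivot i) (e i) x) :
    ((c (n + 2)).rootMultiplicity x : ℤ) =
      (c (n + 1)).rootMultiplicity x + 2 * (c n).rootMultiplicity x + e (n + 1) := by
  have h0 := hasOrderAt_rootMultiplicity (c_monic n).ne_zero x
  have h1 := hasOrderAt_rootMultiplicity (c_monic (n + 1)).ne_zero x
  have h2 := hasOrderAt_rootMultiplicity (c_monic (n + 2)).ne_zero x
  have := (h1.mul (h0.mul h0)).mul (h (n + 1) (by omega))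
  rw [h2.unique (this.congr ?_)]
  · ring
  · have hev : ∀ᶠ t in 𝓝[≠] x, ∀ i ∈ Finset.range (n + 2), pivot i t ≠ 0 :=
      (Finset.eventually_all _).2 fun i hi => (h i (Finset.mem_range.1 hi)).eventually_ne
    filter_upwards [hev] with t ht
    rw [eval_c_add_two fun i hi => ht i (Finset.mem_range.2 hi)]
    ring

lemma rootMultiplicity_c_of_pivot_ne_zero {x : ℝ} :
    ∀ n : ℕ, (∀ j < n, pivot j x ≠ 0) → (c n).rootMultiplicity x = 0
  | 0, _ => rootMultiplicity_c_zero x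
  | 1, h => by
    have := rootMultiplicity_c_one (hasOrderAt_pivot_of_regular
      (regularAt_of_pivot_ne_zero 0 fun j hj => h j (by omega))
      (regularAt_of_pivot_ne_zero 1 fun j hj => h j (by omega)) (h 0 one_pos))
    exact_mod_cast this
  | n + 2, h => by
    have := rootMultiplicity_c_add_two (x := x) (n := n) (e := fun _ => 0) fun i hi =>
      hasOrderAt_pivot_of_regular (regularAt_of_pivot_ne_zero i fun j hj => h j (by omega))
        (regularAt_of_pivot_ne_zero (i + 1) fun j hj => h j (by omega)) (h i hi)
    rw [rootMultiplicity_c_of_pivot_ne_zero n fun j hj => h j (by omega),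
      rootMultiplicity_c_of_pivot_ne_zero (n + 1) fun j hj => h j (by omega)] at this
    simpa using this

/-- The index is k + 1 because c_n involves only the pivots below n, so pivot k first enters
c_{k+1}. -/
lemma rootMultiplicity_c_add {x : ℝ} {k : ℕ} (hlt : ∀ j < k, pivot j x ≠ 0)
    (hk : pivot k x = 0) : ∀ m, (c (k + 1 + m)).rootMultiplicity x = mult m := by
  have hord : ∀ i, HasOrderAt (pivot i) (if i < k then 0 else pivotOrder (i - k)) x := by
    intro i
    split_ifs with h
    · exact hasOrderAt_pivot_of_regular (regularAt_of_pivot_ne_zero i fun j hj => hlt j (by omega))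
        (regularAt_of_pivot_ne_zero (i + 1) fun j hj => hlt j (by omega)) (hlt i h)
    · obtain ⟨m, rfl⟩ := Nat.exists_eq_add_of_le (not_lt.1 h)
      rw [Nat.add_sub_cancel_left]
      exact hasOrderAt_pivot_add hlt hk m
  have h0 : (c k).rootMultiplicity x = 0 := rootMultiplicity_c_of_pivot_ne_zero k hlt
  have h1 : (c (k + 1)).rootMultiplicity x = 1 := by
    cases k with
    | zero =>
      have := rootMultiplicity_c_one (hord 0)
      simp only [lt_irrefl, if_false, Nat.sub_self, pivotOrder] at this
      exact_mod_cast this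
    | succ k =>
      have := rootMultiplicity_c_add_two (n := k) fun i _ => hord i
      rw [h0, rootMultiplicity_c_of_pivot_ne_zero k fun j hj => hlt j (by omega)] at this
      simp only [lt_irrefl, if_false, Nat.sub_self, pivotOrder] at this
      exact_mod_cast this
  intro m
  induction m using Nat.twoStepInduction with
  | zero => exact h1
  | one =>
    have := rootMultiplicity_c_add_two (n := k) fun i _ => hord i
    rw [h0, h1, if_neg (by omega), Nat.add_sub_cancel_left] at this
    simp only [pivotOrder] at this
    change (c (k + 2)).rootMultiplicity x = 0
    omega
  | more m ih1 ih2 =>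
    have := rootMultiplicity_c_add_two (n := k + 1 + m) fun i _ => hord i
    rw [if_neg (by omega), show k + 1 + m + 1 - k = m + 2 by omega] at this
    have h2 := mult_add_two m
    rw [← add_assoc] at ih2
    rw [ih1, ih2] at this
    rw [← add_assoc]
    omega

/-- Each number is either never a root of a `c n`, or it is a root of multiplicity `mult m` of
`c (k + m)`, where `c k` is the first of the polynomials with this root. -/
lemma rootMultiplicity_c_dichotomy (x : ℝ) : (∀ n, (c n).rootMultiplicity x = 0) ∨
    ∃ k, 1 ≤ k ∧ (∀ n < k, (c n).rootMultiplicity x = 0) ∧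
      ∀ m, (c (k + m)).rootMultiplicity x = mult m := by
  classical
  by_cases h : ∃ k, pivot k x = 0
  · right
    have hlt : ∀ j < Nat.find h, pivot j x ≠ 0 := fun j hj => Nat.find_min h hj
    exact ⟨Nat.find h + 1, by omega, fun n hn => rootMultiplicity_c_of_pivot_ne_zero n
      fun j hj => hlt j (by omega), rootMultiplicity_c_add hlt (Nat.find_spec h)⟩
  · left
    push Not at h
    exact fun n => rootMultiplicity_c_of_pivot_ne_zero n fun j _ => h j

lemma isRoot_c_iff {n : ℕ} {x : ℝ} : (c n).IsRoot x ↔ (c n).rootMultiplicity x ≠ 0 := by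
  rw [← Nat.pos_iff_ne_zero, rootMultiplicity_pos (c_monic n).ne_zero]

lemma rootMultiplicity_c_of_first {k n : ℕ} {x : ℝ} (hk : (c k).IsRoot x)
    (hlt : ∀ j < k, ¬ (c j).IsRoot x) (hn : k ≤ n) :
    (c n).rootMultiplicity x = mult (n - k) := by
  rw [isRoot_c_iff] at hk
  rcases rootMultiplicity_c_dichotomy x with h | ⟨l, -, hl, h⟩
  · exact absurd (h k) hk
  · have hlk : l ≤ k := by
      by_contra! hc
      exact hk (hl k hc)
    have : ¬ l < k := fun hc => hlt l hc (isRoot_c_iff.2 (by rw [← add_zero l, h 0]; simp [mult]))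
    obtain rfl : l = k := by omega
    obtain ⟨m, rfl⟩ := Nat.exists_eq_add_of_le hn
    rw [Nat.add_sub_cancel_left, h]

/-! ### The new factors -/

/-- The numbers that are roots of `c n` but not of any earlier one. -/
noncomputable def newRoots (n : ℕ) : Finset ℝ := by
  classical exact (c n).roots.toFinset.filter fun x => ∀ j < n, ¬ (c j).IsRoot x

lemma mem_newRoots {n : ℕ} {x : ℝ} :
    x ∈ newRoots n ↔ (c n).IsRoot x ∧ ∀ j < n, ¬ (c j).IsRoot x := by
  classical
  simp [newRoots, (c_monic n).ne_zero]

/-- The polynomial with simple roots at the new roots. -/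
noncomputable def newFactor (n : ℕ) : ℝ[X] := ∏ x ∈ newRoots n, (X - C x)

lemma newFactor_monic (n : ℕ) : (newFactor n).Monic := monic_prod_X_sub_C _ _

lemma roots_newFactor (n : ℕ) : (newFactor n).roots = (newRoots n).val := roots_prod_X_sub_C _

lemma splits_newFactor (n : ℕ) : (newFactor n).Splits :=
  Splits.prod fun _ _ => Splits.X_sub_C _

lemma rootMultiplicity_newFactor (n : ℕ) (x : ℝ) [Decidable (x ∈ newRoots n)] :
    (newFactor n).rootMultiplicity x = if x ∈ newRoots n then 1 else 0 := by
  classical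
  rw [← count_roots, roots_newFactor, Multiset.count_eq_of_nodup (newRoots n).nodup]
  simp

lemma isRoot_newFactor {n : ℕ} {x : ℝ} : (newFactor n).IsRoot x ↔ x ∈ newRoots n := by
  rw [← mem_roots (newFactor_monic n).ne_zero, roots_newFactor, Finset.mem_val]

lemma newFactor_zero : newFactor 0 = 1 := by
  have : newRoots 0 = ∅ := by
    refine Finset.eq_empty_of_forall_notMem fun x hx => ?_
    exact isRoot_c_iff.1 (mem_newRoots.1 hx).1 (rootMultiplicity_c_zero x)
  rw [newFactor, this, Finset.prod_empty]

lemma isCoprime_newFactor {n k : ℕ} (h : k < n) : IsCoprime (newFactor n) (newFactor k) := by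
  refine IsCoprime.prod_left fun x hx => IsCoprime.prod_right fun y hy => ?_
  refine isCoprime_X_sub_C_of_isUnit_sub (sub_ne_zero.2 ?_).isUnit
  rintro rfl
  exact (mem_newRoots.1 hx).2 k h (mem_newRoots.1 hy).1

/-- Both sides are monic and split, so it suffices to compare multiplicities at each x, and x is a
new root at no more than one level. -/
lemma c_eq_prod_newFactor (n : ℕ) :
    c n = ∏ k ∈ Finset.Ico 1 (n + 1), newFactor k ^ mult (n - k) := by
  classical
  have hm : (∏ k ∈ Finset.Ico 1 (n + 1), newFactor k ^ mult (n - k)).Monic :=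
    monic_prod_of_monic _ _ fun k _ => (newFactor_monic k).pow _
  have hs : (∏ k ∈ Finset.Ico 1 (n + 1), newFactor k ^ mult (n - k)).Splits :=
    Splits.prod fun k _ => (splits_newFactor k).pow _
  have hc : (c n).Splits := (graph n).splits_charpoly_dirichletLaplacian
  rw [hc.eq_prod_roots_of_monic (c_monic n), hs.eq_prod_roots_of_monic hm]
  congr 2
  ext x
  rw [roots_prod _ _ hm.ne_zero, Multiset.count_bind]
  simp only [roots_pow, Multiset.count_nsmul, count_roots, rootMultiplicity_newFactor]
  change _ = ∑ k ∈ Finset.Ico 1 (n + 1), mult (n - k) * if x ∈ newRoots k then 1 else 0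
  rcases rootMultiplicity_c_dichotomy x with h | ⟨l, hl1, hl, h⟩
  · rw [h n, Finset.sum_eq_zero]
    intro k _
    rw [if_neg, mul_zero]
    exact fun hx => isRoot_c_iff.1 (mem_newRoots.1 hx).1 (h k)
  · have hmem : ∀ k, x ∈ newRoots k ↔ k = l := by
      have hl0 : (c l).IsRoot x := isRoot_c_iff.2 (by rw [← add_zero l, h 0]; simp [mult])
      intro k
      refine ⟨fun hk => ?_, ?_⟩
      · rw [mem_newRoots, isRoot_c_iff] at hk
        refine le_antisymm ?_ ?_
        · by_contra! hc
          exact hk.2 l hc hl0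
        · by_contra! hc
          exact hk.1 (hl k hc)
      · rintro rfl
        exact mem_newRoots.2 ⟨hl0, fun j hj hr => isRoot_c_iff.1 hr (hl j hj)⟩
    simp only [hmem, mul_ite, mul_one, mul_zero, Finset.sum_ite_eq', Finset.mem_Ico]
    split_ifs with hn
    · obtain ⟨m, rfl⟩ := Nat.exists_eq_add_of_le (Nat.lt_succ_iff.1 hn.2)
      rw [h, Nat.add_sub_cancel_left]
    · exact hl n (by omega)

lemma c_eq_newFactor_mul {n : ℕ} (hn : 1 ≤ n) :
    c n = newFactor n * ∏ k ∈ Finset.Ico 1 n, newFactor k ^ mult (n - k) := by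
  rw [c_eq_prod_newFactor, Finset.prod_Ico_succ_top hn, Nat.sub_self, mul_comm]
  simp [mult]

lemma numV_eq_sum (n : ℕ) :
    numV n = ∑ k ∈ Finset.Ico 1 (n + 1), mult (n - k) * (newFactor k).natDegree := by
  rw [← natDegree_c, c_eq_prod_newFactor, natDegree_prod_of_monic _ _
    fun k _ => (newFactor_monic k).pow _]
  exact Finset.sum_congr rfl fun k _ => (newFactor_monic k).natDegree_pow _

/-- Without new roots at level n + 2, `mult_add_two_le` would bound the degree of c_{n+2} by deg
c_{n+1} + 2 deg c_n, one less than its true value. -/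
lemma natDegree_newFactor_ne_zero {n : ℕ} (hn : 1 ≤ n) : (newFactor n).natDegree ≠ 0 := by
  intro h0
  have h1 := numV_eq_sum n
  rw [Finset.sum_Ico_succ_top hn, h0, mul_zero, add_zero] at h1
  match n, hn with
  | 1, _ => simp [numV_succ, numV_zero, numA_zero] at h1
  | n + 2, _ =>
    have h2 := numV_eq_sum (n + 1)
    have h3 := numV_eq_sum n
    have h4 := numV_add_two n
    rw [Finset.sum_Ico_succ_top (by omega)] at h1 h2
    have h5 : ∑ k ∈ Finset.Ico 1 (n + 1), mult (n + 2 - k) * (newFactor k).natDegree ≤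
        ∑ k ∈ Finset.Ico 1 (n + 1), mult (n + 1 - k) * (newFactor k).natDegree +
        2 * ∑ k ∈ Finset.Ico 1 (n + 1), mult (n - k) * (newFactor k).natDegree := by
      rw [Finset.mul_sum, ← Finset.sum_add_distrib]
      refine Finset.sum_le_sum fun k hk => ?_
      have hk' := Nat.lt_succ_iff.1 (Finset.mem_Ico.1 hk).2
      have := mult_add_two_le (n - k)
      rw [show n + 2 - k = n - k + 2 by omega, show n + 1 - k = n - k + 1 by omega, ← mul_assoc,
        ← add_mul]
      exact Nat.mul_le_mul_right _ this
    -- The roots new at level n + 1 are absent one level later.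
    have h6 : mult (n + 2 - (n + 1)) = 0 := by
      rw [show n + 2 - (n + 1) = 1 by omega]
      rfl
    rw [h6, zero_mul] at h1
    omega

lemma exists_mem_newRoots {n : ℕ} (hn : 1 ≤ n) : ∃ x, x ∈ newRoots n := by
  by_contra! h
  refine natDegree_newFactor_ne_zero hn ?_
  rw [newFactor, Finset.eq_empty_of_forall_notMem h, Finset.prod_empty, natDegree_one]

lemma isNewFactorSequence_newFactor :
    IsNewFactorSequence newFactor fun n k => mult (n - k) where
  zero := newFactor_zero
  coprime _ _ h := isCoprime_newFactor h
  factor _ hn := c_eq_newFactor_mul hn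

/-! ### Uniqueness of the factors and exponents -/

lemma not_isRoot_of_isCoprime {f g : ℝ[X]} (h : IsCoprime f g) {x : ℝ} (hx : g.IsRoot x) :
    ¬ f.IsRoot x := by
  obtain ⟨a, b, hab⟩ := h
  intro hf
  have := congr_arg (eval x) hab
  simp [hx.eq_zero, hf.eq_zero] at this

lemma rootMultiplicity_mul_prod {f : ℝ[X]} {s : Finset ℕ} {e : ℕ → ℕ} {k : ℕ} {x : ℝ}
    (hf : ¬ f.IsRoot x) (hk : k ∈ s) (hx : x ∈ newRoots k) :
    (f * ∏ j ∈ s, newFactor j ^ e j).rootMultiplicity x = e k := by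
  classical
  have hf0 : f ≠ 0 := by
    rintro rfl
    simp at hf
  have hp : (∏ j ∈ s, newFactor j ^ e j) ≠ 0 :=
    (monic_prod_of_monic _ _ fun j _ => (newFactor_monic j).pow _).ne_zero
  rw [rootMultiplicity_mul (mul_ne_zero hf0 hp), rootMultiplicity_eq_zero hf, zero_add,
    ← count_roots, roots_prod _ _ hp, Multiset.count_bind]
  simp only [roots_pow, Multiset.count_nsmul, count_roots, rootMultiplicity_newFactor]
  change ∑ j ∈ s, e j * (if x ∈ newRoots j then 1 else 0) = _
  rw [Finset.sum_eq_single_of_mem k hk, if_pos hx, mul_one]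
  intro j _ hj
  rw [if_neg, mul_zero]
  intro hxj
  rw [mem_newRoots] at hx hxj
  rcases lt_or_gt_of_ne hj with h | h
  · exact hx.2 j h hxj.1
  · exact hxj.2 k h hx.1

/-- The exponent s_{n,k} is the multiplicity in c_n of any root new at level k: such a root exists,
coprimality keeps it out of γ_n, and it lies in no other earlier factor. Once the exponents are
known, cancellation determines γ_n. -/
lemma IsNewFactorSequence.eq_newFactor {γ : ℕ → ℝ[X]} {s : ℕ → ℕ → ℕ}
    (h : IsNewFactorSequence γ s) (n : ℕ) :
    γ n = newFactor n ∧ ∀ k, 1 ≤ k → k < n → s n k = mult (n - k) := by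
  induction n using Nat.strong_induction_on with
  | _ n ih =>
    rcases Nat.eq_zero_or_pos n with rfl | hn
    · exact ⟨h.zero.trans newFactor_zero.symm, fun k _ hk => absurd hk (Nat.not_lt_zero k)⟩
    have hf : c n = γ n * ∏ k ∈ Finset.Ico 1 n, newFactor k ^ s n k := by
      rw [h.factor n hn]
      congr 1
      exact Finset.prod_congr rfl fun k hk => by rw [(ih k (Finset.mem_Ico.1 hk).2).1]
    have hs : ∀ k, 1 ≤ k → k < n → s n k = mult (n - k) := by
      intro k hk1 hkn
      obtain ⟨x, hx⟩ := exists_mem_newRoots hk1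
      have hx' := mem_newRoots.1 hx
      have hroot : ¬ (γ n).IsRoot x :=
        not_isRoot_of_isCoprime (h.coprime n k hkn) (by rw [(ih k hkn).1]; exact isRoot_newFactor.2 hx)
      rw [← rootMultiplicity_c_of_first hx'.1 hx'.2 hkn.le, hf,
        rootMultiplicity_mul_prod hroot (Finset.mem_Ico.2 ⟨hk1, hkn⟩) hx]
    refine ⟨?_, hs⟩
    have hp : (∏ k ∈ Finset.Ico 1 n, newFactor k ^ mult (n - k)) ≠ 0 :=
      (monic_prod_of_monic _ _ fun j _ => (newFactor_monic j).pow _).ne_zero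
    refine mul_right_cancel₀ hp ?_
    rw [← c_eq_newFactor_mul hn, hf]
    congr 1
    exact Finset.prod_congr rfl fun k hk => by
      rw [hs k (Finset.mem_Ico.1 hk).1 (Finset.mem_Ico.1 hk).2]

lemma hasEigenvalue_dirichlet_iff {n : ℕ} {x : ℝ} :
    (dirichlet n).HasEigenvalue x ↔ (c n).IsRoot x :=
  Module.End.hasEigenvalue_iff_isRoot_charpoly _ _

end Basilica

theorem mainTheorem4 :
    ∃ S : ℕ → ℕ,
      (∀ m : ℕ, (S m : ℚ) =
        (9 + 23 * (-1) ^ m + 2 ^ (m + 2) - 6 * (m : ℚ) * (-1) ^ m) / 36) ∧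
      (∃ (γ : ℕ → ℝ[X]) (s : ℕ → ℕ → ℕ), Basilica.IsNewFactorSequence γ s) ∧
      (∀ (γ : ℕ → ℝ[X]) (s : ℕ → ℕ → ℕ), Basilica.IsNewFactorSequence γ s →
        (∀ n k : ℕ, 1 ≤ k → k < n → s n k = S (n - k)) ∧
        (∀ n : ℕ, 1 ≤ n →
          Basilica.c n = γ n * ∏ k ∈ Finset.Ico 1 n, γ k ^ S (n - k)) ∧
        (∀ k : ℕ, (γ k).Splits ∧
          ∀ x : ℝ, (γ k).IsRoot x → (γ k).rootMultiplicity x = 1) ∧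
        (∀ j k : ℕ, j ≠ k → IsCoprime (γ j) (γ k))) ∧
      (∀ (k n : ℕ) (x : ℝ), k ≤ n →
        (Basilica.dirichlet k).HasEigenvalue x →
        (∀ j : ℕ, j < k → ¬ (Basilica.dirichlet j).HasEigenvalue x) →
        (Basilica.c n).rootMultiplicity x = S (n - k) ∧
        Module.finrank ℝ ((Basilica.dirichlet n).eigenspace x) = S (n - k)) := by
  classical
  refine ⟨Basilica.mult, Basilica.mult_eq, ⟨_, _, Basilica.isNewFactorSequence_newFactor⟩, ?_, ?_⟩
  · intro γ s h
    obtain rfl : γ = Basilica.newFactor := funext fun n => (h.eq_newFactor n).1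
    refine ⟨fun n => (h.eq_newFactor n).2, fun n hn => Basilica.c_eq_newFactor_mul hn,
      fun k => ⟨Basilica.splits_newFactor k, fun x hx => ?_⟩, fun j k hjk => ?_⟩
    · rw [Basilica.rootMultiplicity_newFactor, if_pos (Basilica.isRoot_newFactor.1 hx)]
    · rcases lt_or_gt_of_ne hjk with hlt | hlt
      · exact (h.coprime k j hlt).symm
      · exact h.coprime j k hlt
  · intro k n x hkn hk hlt
    simp only [Basilica.hasEigenvalue_dirichlet_iff] at hk hlt
    have := Basilica.rootMultiplicity_c_of_first hk hlt hkn
    exact ⟨this, ((Basilica.graph n).finrank_eigenspace_dirichletLaplacian x).trans this⟩
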